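/- A map $f\colon X\to Y$ between metric spaces is a coarse embedding if there are non-decreasing functions $\rho_-,\rho_+\colon[0,\infty)\to[0,\infty)$ with $\lim_{t\to\infty}\rho_-(t)=\infty$ and $\rho_-(d(x,x'))\le d(f(x),f(x'))\le\rho_+(d(x,x'))$ for all $x,x'\in X$. **Theorem.** Let $X$ be a metric space that coarsely embeds into a Hilbert space, and let $G$ be a finite group acting on $X$ by isometries. Then the orbit space $X/G$, with the quotient metric $d([x],[y])=\inf_{x'\in[x],\,y'\in[y]}d(x',y')=\inf_{g\in G}d(x,g\cdot y)$, coarsely embeds into a Hilbert space. -/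

import Mathlib

open scoped NNReal

universe u v w

/-- A map `f` between metric spaces is a coarse embedding if there are non-decreasing control
functions `ρ₋, ρ₊ : [0, ∞) → [0, ∞)` with `ρ₋ t → ∞` as `t → ∞` and
`ρ₋ (d (x, x')) ≤ d (f x, f x') ≤ ρ₊ (d (x, x'))` for all `x, x'`. -/
def IsCoarseEmbedding {X Y : Type*} [MetricSpace X] [MetricSpace Y] (f : X → Y) : Prop :=
  ∃ ρₗ ρᵤ : ℝ≥0 → ℝ≥0, Monotone ρₗ ∧ Monotone ρᵤ ∧
    Filter.Tendsto ρₗ Filter.atTop Filter.atTop ∧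
    ∀ x x' : X, ρₗ (nndist x x') ≤ nndist (f x) (f x') ∧
      nndist (f x) (f x') ≤ ρᵤ (nndist x x')

/-- `X` coarsely embeds into a (real) Hilbert space living in the universe `v`.
No restriction is put on the dimension of the Hilbert space. -/
def CoarselyEmbedsIntoHilbertSpace (X : Type u) [MetricSpace X] : Prop :=
  ∃ (H : Type v) (_ : NormedAddCommGroup H) (_ : InnerProductSpace ℝ H) (_ : CompleteSpace H)
    (f : X → H), IsCoarseEmbedding f

/-- The set `X/G` of orbits of the action of `G` on `X`. -/
def OrbitSpace (G X : Type*) [Group G] [MulAction G X] : Type _ :=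
  MulAction.orbitRel.Quotient G X

namespace OrbitSpace

variable {G X : Type*} [Group G] [MulAction G X]

/-- The orbit `[x]` of a point `x`. -/
def mk (G : Type*) {X : Type*} [Group G] [MulAction G X] (x : X) : OrbitSpace G X :=
  Quotient.mk (MulAction.orbitRel G X) x

theorem mk_surjective (p : OrbitSpace G X) : ∃ x : X, mk G x = p :=
  Quotient.exists_rep p

theorem mk_eq_mk_iff {x y : X} : mk G x = mk G y ↔ ∃ g : G, g • y = x := by
  exact (Quotient.eq (r := MulAction.orbitRel G X)).trans
    (MulAction.orbitRel_apply.trans MulAction.mem_orbit_iff)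

variable [MetricSpace X]

/-- The quotient distance: `d(p, q)` is the infimum of the distances `d(x, y)` over all points
`x` of the orbit `p` and all points `y` of the orbit `q`. -/
noncomputable instance : Dist (OrbitSpace G X) :=
  ⟨fun p q => sInf {r : ℝ | ∃ x y : X, mk G x = p ∧ mk G y = q ∧ r = dist x y}⟩

theorem dist_def (p q : OrbitSpace G X) :
    dist p q = sInf {r : ℝ | ∃ x y : X, mk G x = p ∧ mk G y = q ∧ r = dist x y} := rfl

variable [IsIsometricSMul G X]

theorem dist_mk_mk (x y : X) : dist (mk G x) (mk G y) = ⨅ g : G, dist x (g • y) := by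
  rw [dist_def, iInf]
  congr 1
  ext r
  constructor
  · rintro ⟨x', y', hx, hy, rfl⟩
    obtain ⟨a, rfl⟩ := mk_eq_mk_iff.1 hx
    obtain ⟨b, rfl⟩ := mk_eq_mk_iff.1 hy
    refine ⟨a⁻¹ * b, ?_⟩
    change dist x ((a⁻¹ * b) • y) = dist (a • x) (b • y)
    rw [← dist_smul a x, smul_smul, mul_inv_cancel_left]
  · rintro ⟨g, rfl⟩
    exact ⟨x, g • y, rfl, mk_eq_mk_iff.2 ⟨g, rfl⟩, rfl⟩

theorem dist_mk_mk_le (x y : X) (g : G) : dist (mk G x) (mk G y) ≤ dist x (g • y) := by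
  rw [dist_mk_mk]
  exact ciInf_le ⟨0, by rintro _ ⟨g, rfl⟩; exact dist_nonneg⟩ g

theorem exists_dist_mk_mk_eq [Finite G] (x y : X) :
    ∃ g : G, dist (mk G x) (mk G y) = dist x (g • y) := by
  obtain ⟨g, hg⟩ := exists_eq_ciInf_of_finite (f := fun g : G => dist x (g • y))
  exact ⟨g, by rw [dist_mk_mk, hg]⟩

/-- For a finite group acting by isometries, the quotient distance is a metric. -/
noncomputable instance [Finite G] : MetricSpace (OrbitSpace G X) where
  dist_self p := by
    obtain ⟨x, rfl⟩ := mk_surjective p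
    obtain ⟨g, hg⟩ := exists_dist_mk_mk_eq (G := G) x x
    have h := dist_mk_mk_le (G := G) x x 1
    rw [one_smul, dist_self] at h
    exact le_antisymm h (hg ▸ dist_nonneg)
  dist_comm p q := by
    rw [dist_def, dist_def]
    congr 1
    ext r
    constructor
    · rintro ⟨x, y, hx, hy, rfl⟩
      exact ⟨y, x, hy, hx, dist_comm x y⟩
    · rintro ⟨x, y, hx, hy, rfl⟩
      exact ⟨y, x, hy, hx, dist_comm x y⟩
  dist_triangle p q s := by
    obtain ⟨x, rfl⟩ := mk_surjective p
    obtain ⟨y, rfl⟩ := mk_surjective q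
    obtain ⟨z, rfl⟩ := mk_surjective s
    obtain ⟨a, ha⟩ := exists_dist_mk_mk_eq (G := G) x y
    obtain ⟨b, hb⟩ := exists_dist_mk_mk_eq (G := G) y z
    calc dist (mk G x) (mk G z) ≤ dist x ((a * b) • z) := dist_mk_mk_le x z (a * b)
      _ ≤ dist x (a • y) + dist (a • y) ((a * b) • z) := dist_triangle _ _ _
      _ = dist (mk G x) (mk G y) + dist (mk G y) (mk G z) := by
        rw [ha, hb, mul_smul, dist_smul]
  eq_of_dist_eq_zero := by
    intro p q h
    obtain ⟨x, rfl⟩ := mk_surjective p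
    obtain ⟨y, rfl⟩ := mk_surjective q
    obtain ⟨g, hg⟩ := exists_dist_mk_mk_eq (G := G) x y
    exact mk_eq_mk_iff.2 ⟨g, (dist_eq_zero.1 (hg ▸ h)).symm⟩

end OrbitSpace

open Filter Topology Matrix

/-! Averaging an embedding `f` over orbits can cancel: for `±1` acting on the line, `x + (-x) = 0`.
The cure is to replace `f` first by Gaussian feature maps. By Schoenberg, `exp (-t * dist (f x) (f
y) ^ 2)` is a positive semidefinite kernel, so it is the Gram matrix of unit vectors `ψ x`. Their
inner products are positive, hence orbit sums cannot cancel: each has squared norm at least `|G|`.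
Far-apart orbits have nearly orthogonal sums, and for small `t` nearby orbits have nearly equal sums
(`exists_orbitSpace_map_of_scale`). An ℓ² sum over countably many scales gives the embedding
(`coarselyEmbedsIntoHilbertSpace_of_forall_exists`). -/

/-- A map that is bounded on bounded scales and expands large scales is a coarse embedding. -/
theorem isCoarseEmbedding_of_bounded {X Y : Type*} [MetricSpace X] [MetricSpace Y] (f : X → Y)
    (hu : ∀ R : ℝ, ∃ C : ℝ, ∀ x y, dist x y ≤ R → dist (f x) (f y) ≤ C)
    (hl : ∀ C : ℝ, ∃ S : ℝ, ∀ x y, S ≤ dist x y → C ≤ dist (f x) (f y)) :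
    IsCoarseEmbedding f := by
  have hbdd : ∀ r : ℝ≥0, BddAbove {s : ℝ≥0 | ∃ x y, nndist x y ≤ r ∧ s = nndist (f x) (f y)} := by
    intro r
    obtain ⟨C, hC⟩ := hu r
    refine ⟨C.toNNReal, ?_⟩
    rintro _ ⟨x, y, hxy, rfl⟩
    refine NNReal.le_toNNReal_of_coe_le ?_
    exact hC x y (by exact_mod_cast hxy)
  -- Adjoining `r` keeps the set nonempty; if `X` is bounded, `sInf ∅ = 0` would otherwise destroy
  -- divergence.
  refine ⟨fun r => sInf ({s : ℝ≥0 | ∃ x y, r ≤ nndist x y ∧ s = nndist (f x) (f y)} ∪ {r}),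
    fun r => sSup {s : ℝ≥0 | ∃ x y, nndist x y ≤ r ∧ s = nndist (f x) (f y)}, ?_, ?_, ?_, ?_⟩
  · intro r s hrs
    refine le_csInf ⟨s, Or.inr rfl⟩ ?_
    rintro b (⟨x, y, hxy, rfl⟩ | rfl)
    · exact csInf_le (OrderBot.bddBelow _) (Or.inl ⟨x, y, hrs.trans hxy, rfl⟩)
    · exact le_trans (csInf_le (OrderBot.bddBelow _) (Or.inr rfl)) hrs
  · intro r s hrs
    rcases Set.eq_empty_or_nonempty
      {s : ℝ≥0 | ∃ x y, nndist x y ≤ r ∧ s = nndist (f x) (f y)} with h | h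
    · simp only [h, csSup_empty]
      exact bot_le
    · exact csSup_le_csSup (hbdd s) h fun b ⟨x, y, hxy, hb⟩ => ⟨x, y, hxy.trans hrs, hb⟩
  · refine tendsto_atTop.2 fun C => ?_
    obtain ⟨S, hS⟩ := hl C
    filter_upwards [eventually_ge_atTop (max S.toNNReal C)] with r hr
    refine le_csInf ⟨r, Or.inr rfl⟩ ?_
    rintro b (⟨x, y, hxy, rfl⟩ | rfl)
    · have h1 : S ≤ dist x y :=
        (Real.le_coe_toNNReal S).trans (by exact_mod_cast (le_max_left _ _).trans (hr.trans hxy))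
      exact_mod_cast hS x y h1
    · exact (le_max_right _ _).trans hr
  · intro x y
    exact ⟨csInf_le (OrderBot.bddBelow _) (Or.inl ⟨x, y, le_rfl, rfl⟩),
      le_csSup (hbdd _) ⟨x, y, le_rfl, rfl⟩⟩

/-! ### Positive semidefinite kernels. -/

/-- Every real positive semidefinite kernel is the Gram matrix of a family of vectors in a
Hilbert space. -/
theorem Matrix.PosSemidef.exists_gram_eq {X : Type u} {K : Matrix X X ℝ} (hK : K.PosSemidef) :
    ∃ (H : Type u) (_ : NormedAddCommGroup H) (_ : InnerProductSpace ℝ H) (_ : CompleteSpace H)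
      (φ : X → H), ∀ x y, inner ℝ (φ x) (φ y) = K x y := by
  -- Reproducing kernels are operator-valued; the scalar `c` becomes multiplication by `c` on `ℝ`.
  let K' : Matrix X X (ℝ →L[ℝ] ℝ) := K.map fun c => c • ContinuousLinearMap.id ℝ ℝ
  have hK' : K'.PosSemidef := by
    have tfae := (RKHS.posSemidef_tfae (K := K')).out 0 2
    refine tfae.2 ⟨?_, fun v => ?_⟩
    · ext x y
      have := hK.isHermitian.apply x y
      simp only [star_trivial] at this
      have hid : (ContinuousLinearMap.id ℝ ℝ).adjoint = ContinuousLinearMap.id ℝ ℝ :=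
        ContinuousLinearMap.adjoint_id
      simp [K', ContinuousLinearMap.star_eq_adjoint, this, hid]
    · have := hK.2 v
      simp only [star_trivial] at this
      rw [Finsupp.sum_comm]
      simpa [K', mul_comm, mul_left_comm, mul_assoc] using this
  have : Fact K'.PosSemidef := ⟨hK'⟩
  refine ⟨RKHS.OfKernel K', inferInstance, inferInstance, inferInstance,
    fun x => RKHS.kerFun (RKHS.OfKernel K') x 1, fun x y => ?_⟩
  have hs := hK.isHermitian.apply x y
  simp only [star_trivial] at hs
  rw [← RKHS.kernel_inner, RKHS.OfKernel.kernel_ofKernel]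
  simp [K', hs]

/-- Gram matrices of arbitrary, possibly infinite, families are positive semidefinite. -/
theorem posSemidef_gram_real {X H : Type*} [NormedAddCommGroup H] [InnerProductSpace ℝ H]
    (f : X → H) : (Matrix.gram ℝ f).PosSemidef := by
  refine ⟨Matrix.isHermitian_gram ℝ f, fun v => ?_⟩
  have h := real_inner_self_nonneg (x := v.sum fun x c => c • f x)
  simp only [Finsupp.sum, sum_inner, inner_sum, real_inner_smul_left, real_inner_smul_right] at h
  rw [Finset.sum_comm] at h
  simpa only [Finsupp.sum, Matrix.gram_apply, star_trivial, mul_comm, mul_left_comm] using h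

theorem Matrix.PosSemidef.of_tendsto {X : Type*} {K : Matrix X X ℝ} {A : ℕ → Matrix X X ℝ}
    (hA : ∀ n, (A n).PosSemidef)
    (h : ∀ x y, Tendsto (fun n => A n x y) atTop (𝓝 (K x y))) : K.PosSemidef := by
  refine ⟨?_, fun v => ?_⟩
  · ext x y
    refine tendsto_nhds_unique (h y x) ((h x y).congr fun n => ?_)
    exact ((hA n).isHermitian.apply y x)
  · refine ge_of_tendsto' (f := fun n => v.sum fun i xi => v.sum fun j xj => star xi * A n i j * xj)
      (x := atTop) ?_ fun n => (hA n).2 v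
    exact tendsto_finsetSum _ fun i _ => tendsto_finsetSum _ fun j _ =>
      ((h i j).const_mul _).mul_const _

theorem Matrix.PosSemidef.map_pow {X : Type*} {K : Matrix X X ℝ} (hK : K.PosSemidef) (n : ℕ) :
    (K.map (· ^ n)).PosSemidef := by
  induction n with
  | zero =>
    have h : K.map (· ^ 0) = Matrix.gram ℝ (fun _ : X => (1 : ℝ)) := by
      ext x y
      simp [Matrix.gram]
    rw [h]
    exact posSemidef_gram_real _
  | succ n ih =>
    have h : K.map (· ^ (n + 1)) = K.map (· ^ n) ⊙ K := by
      ext x y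
      simp [pow_succ]
    rw [h]
    exact ih.hadamard hK

/-- Partial sums of the exponential series are nonnegative combinations of Hadamard powers, positive
semidefinite by Schur's product theorem. -/
theorem Matrix.PosSemidef.map_exp {X : Type*} {K : Matrix X X ℝ} (hK : K.PosSemidef) :
    (K.map Real.exp).PosSemidef := by
  refine Matrix.PosSemidef.of_tendsto
    (A := fun n => ∑ k ∈ Finset.range n, ((k.factorial : ℝ)⁻¹) • K.map (· ^ k)) (fun n => ?_)
    fun x y => ?_
  · exact Matrix.posSemidef_sum _ fun k _ => (hK.map_pow k).smul (by positivity)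
  · have := (NormedSpace.expSeries_div_hasSum_exp (K x y)).tendsto_sum_nat
    rw [← Real.exp_eq_exp_ℝ] at this
    simpa [Matrix.sum_apply, div_eq_inv_mul] using this

/-- The Gaussian kernel on a real inner product space is positive semidefinite. -/
theorem posSemidef_gaussian {X H : Type*} [NormedAddCommGroup H] [InnerProductSpace ℝ H]
    (f : X → H) {t : ℝ} (ht : 0 ≤ t) :
    (Matrix.of fun x y => Real.exp (-t * dist (f x) (f y) ^ 2)).PosSemidef := by
  -- Expanding the square: `exp (-t‖a - b‖²) = exp (-t‖a‖²) exp (-t‖b‖²) exp (2t⟪a, b⟫)`.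
  have h1 := ((posSemidef_gram_real f).smul (mul_nonneg zero_le_two ht)).map_exp
  have h2 := posSemidef_gram_real (fun x => Real.exp (-t * ‖f x‖ ^ 2))
  refine (congrArg Matrix.PosSemidef ?_).mp (h2.hadamard h1)
  ext x y
  simp only [Matrix.of_apply, Matrix.hadamard_apply, Matrix.gram, Matrix.map_apply,
    Matrix.smul_apply, smul_eq_mul, dist_eq_norm, norm_sub_sq_real, RCLike.inner_apply,
    conj_trivial, ← Real.exp_add]
  ring_nf

/-! ### Gluing the scales. -/

/-- Gluing: a metric space coarsely embeds into a Hilbert space if it has uniformly bounded maps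
into Hilbert spaces, arbitrarily close to constant on any given scale, which separate points at
large distance by a uniform amount. -/
theorem coarselyEmbedsIntoHilbertSpace_of_forall_exists {Y : Type u} [MetricSpace Y] (B : ℝ)
    (h : ∀ R ε : ℝ, 0 < ε → ∃ (H : Type u) (_ : NormedAddCommGroup H) (_ : InnerProductSpace ℝ H)
      (_ : CompleteSpace H) (Φ : Y → H), (∀ p q, dist (Φ p) (Φ q) ≤ B) ∧
      (∀ p q, dist p q ≤ R → dist (Φ p) (Φ q) ≤ ε) ∧
      ∃ S : ℝ, ∀ p q, S ≤ dist p q → 1 ≤ dist (Φ p) (Φ q)) :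
    CoarselyEmbedsIntoHilbertSpace.{u, u} Y := by
  -- With scale `k` and tolerance `2⁻ᵏ`, points within `N` have only the first `N` terms not
  -- controlled by the geometric series.
  choose H i₁ i₂ i₃ Φ hB hR S hS using fun k : ℕ =>
    h k ((1 / 2 : ℝ) ^ k) (by positivity)
  have hnear : ∀ (p q : Y) (N : ℕ), dist p q ≤ N → ∀ k, dist (Φ k p) (Φ k q) ^ 2 ≤
      (if k < N then B ^ 2 else 0) + (1 / 2 : ℝ) ^ k := by
    intro p q N hN k
    split_ifs with hk
    · have := pow_le_pow_left₀ dist_nonneg (hB k p q) 2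
      have : (0 : ℝ) ≤ (1 / 2) ^ k := by positivity
      linarith
    · have h1 := hR k p q (hN.trans (by exact_mod_cast not_lt.1 hk))
      have h2 : ((1 : ℝ) / 2) ^ k ≤ 1 := pow_le_one₀ (by norm_num) (by norm_num)
      have h3 : (0 : ℝ) ≤ (1 / 2) ^ k := by positivity
      nlinarith [pow_le_pow_left₀ dist_nonneg h1 2]
  have hfin : ∀ N : ℕ, Summable fun k => if k < N then B ^ 2 else 0 := fun N =>
    summable_of_ne_finset_zero (s := Finset.range N) fun k hk => if_neg (by simpa using hk)
  have hgeo : Summable fun k : ℕ => (1 / 2 : ℝ) ^ k :=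
    summable_geometric_of_lt_one (by norm_num) (by norm_num)
  have hsum : ∀ p q, Summable fun k => dist (Φ k p) (Φ k q) ^ 2 := by
    intro p q
    obtain ⟨N, hN⟩ := exists_nat_ge (dist p q)
    exact Summable.of_nonneg_of_le (fun k => by positivity) (hnear p q N hN)
      ((hfin N).add hgeo)
  rcases isEmpty_or_nonempty Y with hY | ⟨⟨o⟩⟩
  · exact ⟨H 0, i₁ 0, i₂ 0, i₃ 0, Φ 0, isCoarseEmbedding_of_bounded _
      (fun R => ⟨0, fun x => isEmptyElim x⟩) fun C => ⟨0, fun x => isEmptyElim x⟩⟩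
  have hmem : ∀ p, Memℓp (fun k => Φ k p - Φ k o) 2 := fun p => by
    refine memℓp_gen ?_
    simpa [dist_eq_norm] using hsum p o
  -- Subtracting the base point value puts the sequence in ℓ² and leaves differences unchanged.
  let F : Y → lp H 2 := fun p => ⟨fun k => Φ k p - Φ k o, hmem p⟩
  have hF : ∀ p q, dist (F p) (F q) ^ 2 = ∑' k, dist (Φ k p) (Φ k q) ^ 2 := by
    intro p q
    have := lp.norm_rpow_eq_tsum (p := 2) (by norm_num) (F p - F q)
    have hk : ∀ k, (F p - F q) k = Φ k p - Φ k q := fun k =>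
      sub_sub_sub_cancel_right (Φ k p) (Φ k q) (Φ k o)
    simp only [hk] at this
    simpa [dist_eq_norm] using this
  refine ⟨lp H 2, inferInstance, inferInstance, inferInstance, F,
    isCoarseEmbedding_of_bounded F (fun R => ?_) fun C => ?_⟩
  · obtain ⟨N, hN⟩ := exists_nat_ge R
    refine ⟨√(∑' k, ((if k < N then B ^ 2 else 0) + (1 / 2 : ℝ) ^ k)), fun p q hpq => ?_⟩
    refine Real.le_sqrt_of_sq_le ?_
    rw [hF]
    exact (hsum p q).tsum_le_tsum (hnear p q N (hpq.trans hN)) ((hfin N).add hgeo)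
  · obtain ⟨N, hN⟩ := exists_nat_ge (C ^ 2)
    -- Beyond this distance the first `N ≥ C ^ 2` terms are each at least `1`.
    refine ⟨∑ k ∈ Finset.range N, |S k|, fun p q hpq => ?_⟩
    refine le_of_sq_le_sq ?_ dist_nonneg
    rw [hF]
    refine hN.trans (le_trans ?_ ((hsum p q).sum_le_tsum (Finset.range N) fun _ _ => by positivity))
    calc (N : ℝ) = ∑ k ∈ Finset.range N, (1 : ℝ) := by simp
      _ ≤ _ := Finset.sum_le_sum fun k hk => one_le_pow₀ (hS k p q ?_)
    exact (le_abs_self _).trans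
      ((Finset.single_le_sum (fun i _ => abs_nonneg (S i)) hk).trans hpq)

/-! ### Orbit sums. -/

/-- The sum of the values of a map over the orbits of a finite group. -/
noncomputable def orbitSum (G : Type*) {X E : Type*} [Group G] [Fintype G] [MulAction G X]
    [AddCommMonoid E] (ψ : X → E) (p : OrbitSpace G X) : E :=
  ∑ g : G, ψ (g • Quotient.out p)

theorem orbitSum_mk {G X E : Type*} [Group G] [Fintype G] [MulAction G X]
    [AddCommMonoid E] (ψ : X → E) (x : X) :
    orbitSum G ψ (OrbitSpace.mk G x) = ∑ g : G, ψ (g • x) := by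
  obtain ⟨a, ha⟩ := OrbitSpace.mk_eq_mk_iff.1
    (Quotient.out_eq (OrbitSpace.mk G x) : OrbitSpace.mk G (Quotient.out _) = OrbitSpace.mk G x)
  rw [orbitSum, ← ha]
  simp_rw [smul_smul]
  exact Fintype.sum_equiv (Equiv.mulRight a) _ _ fun g => rfl

/-- If `X` coarsely embeds into a Hilbert space, then `X / G` has uniformly bounded maps into Hilbert
spaces, almost constant at a given scale and separating points at large distance. -/
theorem exists_orbitSpace_map_of_scale (X : Type u) [MetricSpace X] (G : Type w) [Group G]
    [Fintype G] [MulAction G X] [IsIsometricSMul G X] {H : Type v} [NormedAddCommGroup H]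
    [InnerProductSpace ℝ H] {f : X → H} (hf : IsCoarseEmbedding f) (R ε : ℝ) (hε : 0 < ε) :
    ∃ (E : Type u) (_ : NormedAddCommGroup E) (_ : InnerProductSpace ℝ E)
      (_ : CompleteSpace E) (Φ : OrbitSpace G X → E),
      (∀ p q, dist (Φ p) (Φ q) ≤ 2 * Fintype.card G) ∧
      (∀ p q, dist p q ≤ R → dist (Φ p) (Φ q) ≤ ε) ∧
      ∃ S : ℝ, ∀ p q, S ≤ dist p q → 1 ≤ dist (Φ p) (Φ q) := by
  obtain ⟨ρₗ, ρᵤ, -, hmono, hlim, hρ⟩ := hf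
  set n : ℝ := (Fintype.card G : ℝ) with hn
  have hn1 : 1 ≤ n := Nat.one_le_cast.2 Fintype.card_pos
  have hn0 : 0 < n := by linarith
  set C : ℝ := (ρᵤ R.toNNReal : ℝ)
  -- Chosen so that `2 * t * C ^ 2 ≤ (ε / n) ^ 2`; the `+ 1` covers `C = 0`.
  set t : ℝ := (ε / n) ^ 2 / (2 * (C ^ 2 + 1)) with ht
  have ht0 : 0 < t := by positivity
  obtain ⟨E, i₁, i₂, i₃, ψ, hψ⟩ := (posSemidef_gaussian f ht0.le).exists_gram_eq
  simp only [Matrix.of_apply] at hψ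
  have hnorm : ∀ x, ‖ψ x‖ = 1 := fun x => by
    have := hψ x x
    rw [real_inner_self_eq_norm_sq, dist_self] at this
    have h2 : ‖ψ x‖ ^ 2 = 1 := by simpa using this
    exact (pow_eq_one_iff_of_nonneg (norm_nonneg _) two_ne_zero).1 h2
  have hdist : ∀ x y, dist (ψ x) (ψ y) ^ 2 ≤ 2 * t * dist (f x) (f y) ^ 2 := fun x y => by
    rw [dist_eq_norm, norm_sub_sq_real, hnorm, hnorm, hψ]
    have := Real.add_one_le_exp (-t * dist (f x) (f y) ^ 2)
    linarith
  have hbound : ∀ p, ‖orbitSum G ψ p‖ ≤ n := fun p => by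
    refine (norm_sum_le _ _).trans ?_
    simp [hnorm, hn]
  refine ⟨E, i₁, i₂, i₃, orbitSum G ψ, fun p q => ?_, fun p q hpq => ?_, ?_⟩
  · rw [dist_eq_norm]
    linarith [norm_sub_le (orbitSum G ψ p) (orbitSum G ψ q), hbound p, hbound q]
  · obtain ⟨x, rfl⟩ := OrbitSpace.mk_surjective p
    obtain ⟨y, rfl⟩ := OrbitSpace.mk_surjective q
    -- Pairing `g • x` with `g • a • y` puts all `n` pairs at the quotient distance.
    obtain ⟨a, ha⟩ := OrbitSpace.exists_dist_mk_mk_eq (G := G) x y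
    have hay : OrbitSpace.mk G y = OrbitSpace.mk G (a • y) :=
      OrbitSpace.mk_eq_mk_iff.2 ⟨a⁻¹, inv_smul_smul a y⟩
    rw [ha] at hpq
    rw [hay, orbitSum_mk, orbitSum_mk]
    refine (dist_sum_sum_le _ _ _).trans ?_
    have key : ∀ g : G, dist (ψ (g • x)) (ψ (g • a • y)) ≤ ε / n := fun g => by
      refine le_of_sq_le_sq ((hdist _ _).trans ?_) (by positivity)
      have h1 : dist (f (g • x)) (f (g • a • y)) ≤ C := by
        have h2 := (hρ (g • x) (g • a • y)).2.trans (hmono (b := R.toNNReal)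
          (NNReal.le_toNNReal_of_coe_le (by rwa [coe_nndist, dist_smul])))
        exact_mod_cast h2
      have h3 := pow_le_pow_left₀ dist_nonneg h1 2
      calc 2 * t * dist (f (g • x)) (f (g • a • y)) ^ 2 ≤ 2 * t * (C ^ 2 + 1) := by
            gcongr
            linarith
        _ = (ε / n) ^ 2 := by
            rw [ht]
            field_simp
    calc ∑ g : G, dist (ψ (g • x)) (ψ (g • a • y)) ≤ ∑ _g : G, ε / n :=
          Finset.sum_le_sum fun g _ => key g
      _ = ε := by
          rw [Finset.sum_const, Finset.card_univ, nsmul_eq_mul, ← hn]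
          field_simp
  -- The factor `n ^ 2` counts the cross pairs between two orbits.
  · have hlim' : Tendsto (fun s : ℝ≥0 => n ^ 2 * Real.exp (-t * (ρₗ s : ℝ) ^ 2)) atTop
        (𝓝 (n ^ 2 * 0)) := by
      refine Tendsto.const_mul _ (Real.tendsto_exp_atBot.comp ?_)
      have h1 : Tendsto (fun s => (ρₗ s : ℝ)) atTop atTop :=
        NNReal.tendsto_coe_atTop.2 hlim
      exact ((tendsto_pow_atTop two_ne_zero).comp h1).const_mul_atTop_of_neg (by linarith)
    rw [mul_zero] at hlim'
    obtain ⟨S, hS⟩ := eventually_atTop.1 (hlim'.eventually_le_const (u := 1 / 2) (by norm_num))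
    refine ⟨S, fun p q hpq => ?_⟩
    obtain ⟨x, rfl⟩ := OrbitSpace.mk_surjective p
    obtain ⟨y, rfl⟩ := OrbitSpace.mk_surjective q
    have hself : ∀ z : X, n ≤ ‖orbitSum G ψ (OrbitSpace.mk G z)‖ ^ 2 := fun z => by
      rw [← real_inner_self_eq_norm_sq, orbitSum_mk, sum_inner]
      simp_rw [inner_sum]
      calc n = ∑ _g : G, (1 : ℝ) := by simp [hn]
        _ ≤ _ := Finset.sum_le_sum fun g _ => ?_
      calc (1 : ℝ) = inner ℝ (ψ (g • z)) (ψ (g • z)) := by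
            rw [real_inner_self_eq_norm_sq, hnorm, one_pow]
        _ ≤ _ := Finset.single_le_sum (f := fun h : G => inner ℝ (ψ (g • z)) (ψ (h • z)))
            (fun h _ => by rw [hψ]; positivity) (Finset.mem_univ g)
    have hcross : inner ℝ (orbitSum G ψ (OrbitSpace.mk G x)) (orbitSum G ψ (OrbitSpace.mk G y))
        ≤ 1 / 2 := by
      rw [orbitSum_mk, orbitSum_mk, sum_inner]
      simp_rw [inner_sum]
      have hfar : ∀ g h : G, inner ℝ (ψ (g • x)) (ψ (h • y)) ≤ (1 / 2) / n ^ 2 := by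
        intro g h
        rw [le_div_iff₀' (by positivity), hψ]
        have h1 : S ≤ nndist (g • x) (h • y) := by
          rw [← NNReal.coe_le_coe, coe_nndist]
          have h2 := OrbitSpace.dist_mk_mk_le (G := G) x y (g⁻¹ * h)
          rw [← dist_smul g x, smul_smul, mul_inv_cancel_left] at h2
          exact hpq.trans h2
        refine le_trans ?_ (hS _ h1)
        have h3 : (ρₗ (nndist (g • x) (h • y)) : ℝ) ≤ dist (f (g • x)) (f (h • y)) := by
          exact_mod_cast (hρ (g • x) (h • y)).1
        gcongr n ^ 2 * Real.exp ?_
        have := pow_le_pow_left₀ (NNReal.coe_nonneg _) h3 2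
        nlinarith
      calc ∑ g : G, ∑ h : G, inner ℝ (ψ (g • x)) (ψ (h • y))
          ≤ ∑ _g : G, ∑ _h : G, (1 / 2) / n ^ 2 :=
            Finset.sum_le_sum fun g _ => Finset.sum_le_sum fun h _ => hfar g h
        _ = 1 / 2 := by
            simp only [Finset.sum_const, Finset.card_univ, nsmul_eq_mul, ← hn]
            field_simp
    refine le_of_sq_le_sq ?_ dist_nonneg
    rw [dist_eq_norm, norm_sub_sq_real]
    -- `n + n - 2 * (1 / 2) ≥ 1` since `n ≥ 1`.
    linarith [hself x, hself y]

theorem theorem1 (X : Type u) [MetricSpace X] (G : Type w) [Group G] [Finite G]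
    [MulAction G X] [IsIsometricSMul G X]
    (hX : CoarselyEmbedsIntoHilbertSpace.{u, v} X) :
    CoarselyEmbedsIntoHilbertSpace.{u, u} (OrbitSpace G X) := by
  obtain ⟨H, _, _, _, f, hf⟩ := hX
  have := Fintype.ofFinite G
  exact coarselyEmbedsIntoHilbertSpace_of_forall_exists (2 * Fintype.card G)
    fun R ε hε => exists_orbitSpace_map_of_scale X G hf R ε hε
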